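/- Let $K$ be plain Kolmogorov complexity of binary strings with respect to a fixed universal machine $U$ (so for every partial computable $M$ on binary strings, $K_U\le K_M+O(1)$). Write $x(1:n)$ for the initial segment of length $n$ of an infinite binary sequence $x$, and $\log=\log_2$. For a constant $c$, call $x,y\in\{0,1\}^\infty$ independent with constant $c$ if there is a $d$ (which may depend on $x,y$) such that for all $n,m\ge 1$ $$K(x(1:n)\,y(1:m))\ \ge\ K(x(1:n))+K(y(1:m))-c(\log n+\log m)-d .$$ A truth-table reduction $f:\{0,1\}^\infty\times\{0,1\}^\infty\to\{0,1\}^\infty$ is a map computed by a two-oracle machine that halts on every input $n$ and for all oracles $x,y$, its output being the $n$-th bit of $f(x,y)$. **Theorem.** For every $\delta>0$ and every $c$ there exist a constant $C$ and a truth-table reduction $f$ with the following property. If $x,y\in\{0,1\}^\infty$ are independent with constant $c$ and $K(x(1:n))>C\log n$ and $K(y(1:n))>C\log n$ for all sufficiently large $n$, then $z=f(x,y)$ satisfies $K(z(1:n))>(1-\delta)n$ for infinitely many $n$. Furthermore, there is an infinite computable set $S\subseteq\mathbb N$ such that $K(z(1:n))>(1-\delta)n$ for every $n\in S$. -/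

import Mathlib

open Filter

/-- A machine: a partial function on binary strings, meant to be partial computable. -/
abbrev Machine := List Bool →. List Bool

/-- Plain Kolmogorov complexity `K_M(x) = min {|p| : M(p) = x}`, equal to `⊤` if `M` never
outputs `x`. -/
noncomputable def machineComplexity (M : Machine) (x : List Bool) : ℕ∞ :=
  ⨅ (p : List Bool) (_ : x ∈ M p), (p.length : ℕ∞)

/-- `U` is a universal machine: it is partial computable, and for every partial computable `M`
there is a constant `c` with `K_U(x) ≤ K_M(x) + c` for all strings `x`. -/
def IsUniversalMachine (U : Machine) : Prop :=
  Partrec U ∧ ∀ M : Machine, Partrec M →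
    ∃ c : ℕ, ∀ x : List Bool, machineComplexity U x ≤ machineComplexity M x + c

/-- `K(x)` with respect to `U`, as a natural number. For universal `U` the value
`machineComplexity U x` is finite for every `x`, so nothing is lost by `toNat`. -/
noncomputable def plainK (U : Machine) (x : List Bool) : ℕ :=
  (machineComplexity U x).toNat

/-- Infinite binary sequences; the `n`-th bit, counted from one, is the value at `n - 1`. -/
abbrev BinSeq := ℕ → Bool

/-- The initial segment `x(1:n)`, which has length `n`. -/
def initSeg (x : BinSeq) (n : ℕ) : List Bool := (List.range n).map x

/-- The sequences `x` and `y` are independent, with leading constant `c` in the logarithmic error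
term: `K(x(1:n) y(1:m)) ≥ K(x(1:n)) + K(y(1:m)) - c (log n + log m) - O(1)` for all `n` and `m`.
The additive constant may depend on `x` and `y`. -/
def IndependentWith (U : Machine) (c : ℝ) (x y : BinSeq) : Prop :=
  ∃ d : ℝ, ∀ n m : ℕ, 1 ≤ n → 1 ≤ m →
    (plainK U (initSeg x n) : ℝ) + (plainK U (initSeg y m) : ℝ)
        - c * (Real.logb 2 n + Real.logb 2 m) - d
      ≤ (plainK U (initSeg x n ++ initSeg y m) : ℝ)

/-- The partial functions `ℕ →. ℕ` computed by machines with two oracles, uniformly in the oracle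
sequences. The clauses are those of `Nat.Partrec`, together with the two query operations
`n`-th bit of the first oracle and `n`-th bit of the second oracle. -/
inductive OracleComputable : (BinSeq → BinSeq → ℕ →. ℕ) → Prop
  | zero : OracleComputable fun _ _ _ => Part.some 0
  | succ : OracleComputable fun _ _ n => Part.some (n + 1)
  | left : OracleComputable fun _ _ n => Part.some n.unpair.1
  | right : OracleComputable fun _ _ n => Part.some n.unpair.2
  | queryFirst : OracleComputable fun x _ n => Part.some (x n).toNat
  | querySecond : OracleComputable fun _ y n => Part.some (y n).toNat
  | pair {f g : BinSeq → BinSeq → ℕ →. ℕ} (hf : OracleComputable f) (hg : OracleComputable g) :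
      OracleComputable fun x y n => Nat.pair <$> f x y n <*> g x y n
  | comp {f g : BinSeq → BinSeq → ℕ →. ℕ} (hf : OracleComputable f) (hg : OracleComputable g) :
      OracleComputable fun x y n => g x y n >>= f x y
  | prec {f g : BinSeq → BinSeq → ℕ →. ℕ} (hf : OracleComputable f) (hg : OracleComputable g) :
      OracleComputable fun x y => Nat.unpaired fun a n =>
        n.rec (f x y a) fun k IH => do
          let i ← IH
          g x y (Nat.pair a (Nat.pair k i))
  | rfind {f : BinSeq → BinSeq → ℕ →. ℕ} (hf : OracleComputable f) :
      OracleComputable fun x y a =>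
        Nat.rfind fun n => (fun m => decide (m = 0)) <$> f x y (Nat.pair a n)

/-- A truth-table reduction: some two-oracle machine, on every input `n` and with all oracles
`x` and `y`, halts and outputs the bit `f x y n`. -/
def IsTruthTableReduction (f : BinSeq → BinSeq → BinSeq) : Prop :=
  OracleComputable fun x y n => Part.some (f x y n).toNat

/-!
Colour the pairs of strings of length `2 ^ u` at random with `2 ^ (m * u)` colours. With positive
probability no set of `2 ^ (a * u)` colours is much too popular on any rectangle of side
`2 ^ ((m + 1) * u)`, and a colouring with this property is found by exhaustive search. If `x` and
`y` have complexity at least `(m + 1) * u` and their colour has complexity below `a * u`, then the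
concatenation `x ++ y` lies in an enumerable set which is smaller, by a factor of about
`2 ^ ((m - a) * u)`, than the rectangle of all equally simple pairs. Describing it by its index in
this set shows `K(x y) ≤ K(x) + K(y) - (m - a) u + O(u)`, contradicting independence of the initial
segments of length `2 ^ u` once `m - a` is large compared with `c`.

So the colour has complexity at least `a * u`, out of `m * u` bits. Taking `u` along a geometric
progression of large ratio, and writing the colours one after another, each one makes up almost all
of the initial segment that it completes.
-/

open scoped Finset

/-- A colouring `E` of pairs is balanced if every subrectangle of `X × Y` with sides at most `K`
contains at most `T` pairs whose colour lies in any given set of at most `A` colours from `Z`.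
The finite sets of pairs and colours range over subsets of `X`, `Y` and `Z`, which need not be
finite. -/
def IsBalanced {α β γ : Type*} [DecidableEq γ] (X : Set α) (Y : Set β) (Z : Set γ) (K A T : ℕ)
    (E : α → β → γ) : Prop :=
  ∀ (s : Finset α) (t : Finset β) (a : Finset γ), ↑s ⊆ X → ↑t ⊆ Y → ↑a ⊆ Z →
    #s ≤ K → #t ≤ K → #a ≤ A → #{p ∈ s ×ˢ t | E p.1 p.2 ∈ a} ≤ T

theorem sum_le_mul_of_card_le_mul {α : Type*} {s : Finset α} {w : α → ℕ} {K T : ℕ}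
    (hT : ∀ s' ⊆ s, #s' ≤ K → ∑ x ∈ s', w x ≤ T) (r : ℕ) (hr : #s ≤ r * K) :
    ∑ x ∈ s, w x ≤ r * T := by
  classical
  induction r generalizing s with
  | zero => simp_all
  | succ r ih =>
    obtain ⟨s', hs's, hs'⟩ := Finset.exists_subset_card_eq (min_le_right K #s)
    rw [← Finset.sum_sdiff hs's, add_mul, one_mul]
    refine add_le_add (ih (fun s'' h => hT s'' (h.trans Finset.sdiff_subset)) ?_)
      (hT s' hs's (hs'.trans_le (min_le_left _ _)))
    rw [Finset.card_sdiff_of_subset hs's, hs']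
    rw [add_mul, one_mul] at hr
    omega

namespace IsBalanced

variable {α β γ : Type*} [DecidableEq γ] {X : Set α} {Y : Set β} {Z : Set γ}
  {K A T : ℕ} {E : α → β → γ}

theorem card_filter_le_mul (h : IsBalanced X Y Z K A T E) {s : Finset α} {t : Finset β}
    {a : Finset γ} (hs : ↑s ⊆ X) (ht : ↑t ⊆ Y) (ha : ↑a ⊆ Z) (haA : #a ≤ A) {r₁ r₂ : ℕ}
    (hsK : #s ≤ r₁ * K) (htK : #t ≤ r₂ * K) :
    #{p ∈ s ×ˢ t | E p.1 p.2 ∈ a} ≤ r₁ * (r₂ * T) := by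
  have card_eq_sum (s : Finset α) (t : Finset β) : #{p ∈ s ×ˢ t | E p.1 p.2 ∈ a}
      = ∑ x ∈ s, ∑ y ∈ t, if E x y ∈ a then 1 else 0 := by
    rw [Finset.card_filter, Finset.sum_product]
  rw [card_eq_sum]
  refine sum_le_mul_of_card_le_mul (fun s' hs's hs'K => ?_) r₁ hsK
  rw [Finset.sum_comm]
  refine sum_le_mul_of_card_le_mul (fun t' ht't ht'K => ?_) r₂ htK
  rw [Finset.sum_comm, ← card_eq_sum]
  exact h s' t' a ((Finset.coe_subset.2 hs's).trans hs) ((Finset.coe_subset.2 ht't).trans ht) ha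
    hs'K ht'K haA

theorem comap (h : IsBalanced X Y Z K A T E) {α' β' γ' : Type*} [DecidableEq γ']
    {X' : Set α'} {Y' : Set β'} {Z' : Set γ'} {E' : α' → β' → γ'}
    {f : α' → α} {g : β' → β} {k : γ' → γ}
    (hf : Set.MapsTo f X' X) (hf' : Set.InjOn f X') (hg : Set.MapsTo g Y' Y)
    (hg' : Set.InjOn g Y') (hk : Set.MapsTo k Z' Z)
    (hE : ∀ x ∈ X', ∀ y ∈ Y', E (f x) (g y) = k (E' x y)) : IsBalanced X' Y' Z' K A T E' := by
  classical
  intro s t a hs ht ha hsK htK haA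
  refine le_trans ?_ (h (s.image f) (t.image g) (a.image k) ?_ ?_ ?_
    (Finset.card_image_le.trans hsK) (Finset.card_image_le.trans htK)
    (Finset.card_image_le.trans haA))
  · refine Finset.card_le_card_of_injOn (Prod.map f g) ?_ ?_
    · rintro ⟨x, y⟩ hxy
      obtain ⟨⟨hx, hy⟩, hc⟩ : (x ∈ s ∧ y ∈ t) ∧ E' x y ∈ a := by simpa using hxy
      simpa [hE x (hs hx) y (ht hy)] using
        ⟨⟨⟨x, hx, rfl⟩, ⟨y, hy, rfl⟩⟩, ⟨E' x y, hc, rfl⟩⟩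
    · refine (hf'.prodMap hg').mono ?_
      rintro ⟨x, y⟩ hxy
      obtain ⟨⟨hx, hy⟩, -⟩ : (x ∈ s ∧ y ∈ t) ∧ E' x y ∈ a := by simpa using hxy
      exact ⟨hs hx, ht hy⟩
  all_goals
    rw [Finset.coe_image]
    exact Set.image_subset_iff.2 fun x hx => by solve_by_elim

end IsBalanced

theorem sum_two_pow_card_filter_mem {ι γ : Type*} [Fintype ι] [DecidableEq ι] [Fintype γ]
    [DecidableEq γ] (S : Finset ι) (a : Finset γ) :
    ∑ E : ι → γ, 2 ^ #{i ∈ S | E i ∈ a}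
      = (Fintype.card γ + #a) ^ #S * Fintype.card γ ^ (Fintype.card ι - #S) := by
  have weight_eq_prod (E : ι → γ) :
      2 ^ #{i ∈ S | E i ∈ a} = ∏ i, if i ∈ S ∧ E i ∈ a then 2 else 1 := by
    rw [Finset.prod_ite, Finset.prod_const, Finset.prod_const_one, mul_one]
    congr 2
    ext i
    simp
  have sum_weight (i : ι) : ∑ c : γ, (if i ∈ S ∧ c ∈ a then 2 else 1)
      = if i ∈ S then Fintype.card γ + #a else Fintype.card γ := by
    have ite_eq_add (c : γ) : (if c ∈ a then 2 else 1) = 1 + if c ∈ a then 1 else 0 := by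
      split <;> rfl
    by_cases hi : i ∈ S <;> simp [hi, ite_eq_add, Finset.sum_add_distrib]
  simp_rw [weight_eq_prod]
  rw [← Fintype.prod_sum fun i c => if i ∈ S ∧ c ∈ a then 2 else 1]
  simp_rw [sum_weight]
  rw [Finset.prod_ite, Finset.prod_const, Finset.prod_const, ← Finset.card_compl]
  congr 3 <;> ext i <;> simp

theorem add_pow_le_four_pow_mul_pow {g a n j : ℕ} (hg : 0 < g) (h : n * a ≤ j * g) :
    (g + a) ^ n ≤ 4 ^ j * g ^ n := by
  have hg' : (0 : ℝ) < g := by exact_mod_cast hg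
  have mean_le : (n : ℝ) * (a / g) ≤ j := by
    rw [← mul_div_assoc, div_le_iff₀ hg']
    exact_mod_cast h
  have : ((g : ℝ) + a) ^ n ≤ 4 ^ j * g ^ n := calc
    ((g : ℝ) + a) ^ n = (a / g + 1) ^ n * g ^ n := by
      rw [← mul_pow]; congr 1; field_simp; ring
    _ ≤ Real.exp (a / g) ^ n * g ^ n := by gcongr; exact Real.add_one_le_exp _
    _ = Real.exp (n * (a / g)) * g ^ n := by rw [Real.exp_nat_mul]
    _ ≤ Real.exp j * g ^ n := by gcongr
    _ = Real.exp 1 ^ j * g ^ n := by rw [← Real.exp_nat_mul, mul_one]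
    _ ≤ 4 ^ j * g ^ n := by gcongr; linarith [Real.exp_one_lt_d9]
  exact_mod_cast this

theorem card_filter_lt_card_filter_mem_mul_le {ι γ : Type*} [Fintype ι] [DecidableEq ι]
    [Fintype γ] [DecidableEq γ] [Nonempty γ] (S : Finset ι) (a : Finset γ) {j : ℕ}
    (h : #S * #a ≤ j * Fintype.card γ) :
    #{E : ι → γ | 4 * j < #{i ∈ S | E i ∈ a}} * 4 ^ j
      ≤ Fintype.card γ ^ Fintype.card ι := by
  -- Markov's inequality for the weight `2 ^ #{i ∈ S | E i ∈ a}`.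
  have markov : #{E : ι → γ | 4 * j < #{i ∈ S | E i ∈ a}} * 2 ^ (4 * j)
      ≤ ∑ E : ι → γ, 2 ^ #{i ∈ S | E i ∈ a} := by
    rw [← smul_eq_mul]
    refine (Finset.card_nsmul_le_sum _ _ _ fun E hE => ?_).trans
      (Finset.sum_le_sum_of_subset (Finset.subset_univ _))
    exact Nat.pow_le_pow_right two_pos (Finset.mem_filter.1 hE).2.le
  have : #{E : ι → γ | 4 * j < #{i ∈ S | E i ∈ a}} * 4 ^ j * 4 ^ j
      ≤ Fintype.card γ ^ Fintype.card ι * 4 ^ j := calc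
    _ = #{E : ι → γ | 4 * j < #{i ∈ S | E i ∈ a}} * 2 ^ (4 * j) := by
      rw [mul_assoc, ← mul_pow, pow_mul]; norm_num
    _ ≤ (Fintype.card γ + #a) ^ #S * Fintype.card γ ^ (Fintype.card ι - #S) :=
      markov.trans_eq (sum_two_pow_card_filter_mem S a)
    _ ≤ 4 ^ j * Fintype.card γ ^ #S * Fintype.card γ ^ (Fintype.card ι - #S) := by
      gcongr; exact add_pow_le_four_pow_mul_pow Fintype.card_pos h
    _ = Fintype.card γ ^ Fintype.card ι * 4 ^ j := by
      rw [mul_assoc, ← pow_add, Nat.add_sub_cancel' (Finset.card_le_univ S), mul_comm]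
  exact Nat.le_of_mul_le_mul_right this (by positivity)

theorem exists_image_eq_of_card_le {α : Type*} [DecidableEq α] {s : Finset α} {K : ℕ}
    (hs : s.Nonempty) (hK : #s ≤ K) : ∃ σ : Fin K → α, Finset.univ.image σ = s := by
  obtain ⟨x₀, hx₀⟩ := hs
  refine ⟨fun i => if h : i < #s then s.equivFin.symm ⟨i, h⟩ else x₀, ?_⟩
  ext x
  simp only [Finset.mem_image, Finset.mem_univ, true_and]
  constructor
  · rintro ⟨i, rfl⟩
    split
    exacts [Subtype.coe_prop _, hx₀]
  · intro hx
    refine ⟨⟨s.equivFin ⟨x, hx⟩, (Fin.is_lt _).trans_le hK⟩, ?_⟩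
    simp

theorem exists_isBalanced_univ {α β γ : Type*} [Fintype α] [Fintype β] [Fintype γ] [DecidableEq γ]
    [Nonempty γ] {K A j : ℕ} (hA : K * K * A ≤ j * Fintype.card γ)
    (hj : Fintype.card α ^ K * Fintype.card β ^ K * 2 ^ Fintype.card γ < 4 ^ j) :
    ∃ E : α → β → γ, IsBalanced .univ .univ .univ K A (4 * j) E := by
  classical
  let I := (Fin K → α) × (Fin K → β) × {a : Finset γ // #a ≤ A}
  let rect (i : I) : Finset (α × β) := Finset.univ.image i.1 ×ˢ Finset.univ.image i.2.1
  let bad (i : I) : Finset (α × β → γ) := {E | 4 * j < #{p ∈ rect i | E p ∈ i.2.2.1}}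
  have card_bad (i : I) : (bad i).card * 4 ^ j ≤ Fintype.card (α × β → γ) := by
    rw [Fintype.card_fun]
    refine card_filter_lt_card_filter_mem_mul_le _ _ (le_trans ?_ hA)
    rw [Finset.card_product]
    gcongr
    exacts [Finset.card_image_le.trans_eq (by simp), Finset.card_image_le.trans_eq (by simp),
      i.2.2.2]
  have card_I : Fintype.card I < 4 ^ j := calc
    Fintype.card I ≤ Fintype.card α ^ K * Fintype.card β ^ K * 2 ^ Fintype.card γ := by
      simp only [I, Fintype.card_prod, Fintype.card_fun, Fintype.card_fin, mul_assoc]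
      gcongr
      exact (Fintype.card_subtype_le _).trans_eq Fintype.card_finset
    _ < 4 ^ j := hj
  have card_union : (Finset.univ.biUnion bad).card < (Finset.univ : Finset (α × β → γ)).card := by
    refine Nat.lt_of_mul_lt_mul_right (a := 4 ^ j) ?_
    calc (Finset.univ.biUnion bad).card * 4 ^ j ≤ ∑ i, (bad i).card * 4 ^ j := by
          rw [← Finset.sum_mul]; gcongr; exact Finset.card_biUnion_le
      _ ≤ ∑ _i : I, Fintype.card (α × β → γ) := by gcongr; exact card_bad _
      _ = Fintype.card I * Fintype.card (α × β → γ) := by simp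
      _ < 4 ^ j * Fintype.card (α × β → γ) := by gcongr
      _ = _ := by rw [mul_comm, Finset.card_univ]
  obtain ⟨E, -, hE⟩ := Finset.exists_mem_notMem_of_card_lt_card card_union
  refine ⟨fun x y => E (x, y), fun s t a _ _ _ hs ht ha => not_lt.1 fun hlt => hE ?_⟩
  have hst : (s ×ˢ t).Nonempty :=
    (Finset.card_pos.1 ((Nat.zero_le _).trans_lt hlt)).mono (Finset.filter_subset _ _)
  obtain ⟨σ, rfl⟩ := exists_image_eq_of_card_le hst.fst hs
  obtain ⟨τ, rfl⟩ := exists_image_eq_of_card_le hst.snd ht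
  exact Finset.mem_biUnion.2 ⟨(σ, τ, ⟨a, ha⟩), Finset.mem_univ _, by simpa [bad, rect] using hlt⟩

/-- The number whose binary digits, least significant first, are the bits of a string. -/
def binaryValue (l : List Bool) : ℕ := l.foldr Nat.bit 0

theorem testBit_binaryValue (l : List Bool) (i : ℕ) :
    (binaryValue l).testBit i = l.getD i false := by
  induction l generalizing i with
  | nil => simp [binaryValue]
  | cons b l ih =>
    cases i with
    | zero => exact Nat.testBit_bit_zero b _
    | succ i => exact (Nat.testBit_bit_succ i b _).trans (ih i)

theorem binaryValue_lt (l : List Bool) : binaryValue l < 2 ^ l.length :=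
  Nat.lt_pow_two_of_testBit _ fun i hi => by
    rw [testBit_binaryValue, List.getD_eq_default _ _ hi]

theorem injOn_binaryValue (n : ℕ) : Set.InjOn binaryValue {l | l.length = n} := by
  intro l hl l' hl' h
  refine List.ext_getElem (hl.trans hl'.symm) fun i hi hi' => ?_
  rw [← List.getD_eq_getElem l false hi, ← List.getD_eq_getElem l' false hi',
    ← testBit_binaryValue, h, testBit_binaryValue]

theorem length_initSeg (x : BinSeq) (n : ℕ) : (initSeg x n).length = n := by simp [initSeg]

theorem getD_initSeg (x : BinSeq) (n i : ℕ) :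
    (initSeg x n).getD i false = (decide (i < n) && x i) := by
  by_cases hi : i < n <;> simp [initSeg, List.getD_eq_getElem?_getD, hi]

theorem binaryValue_initSeg_testBit {v n : ℕ} (hv : v < 2 ^ n) :
    binaryValue (initSeg v.testBit n) = v := by
  refine Nat.eq_of_testBit_eq fun i => ?_
  rw [testBit_binaryValue, getD_initSeg]
  by_cases hi : i < n
  · simp [hi]
  · simp [hi, Nat.testBit_lt_two_pow (hv.trans_le (Nat.pow_le_pow_right two_pos (not_lt.1 hi)))]

section Primrec

variable {α : Type*} [Primcodable α]

theorem primrecPred_exists_lt {p : α × ℕ → Prop} {f : α → ℕ} (hp : PrimrecPred p)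
    (hf : Primrec f) : PrimrecPred fun a => ∃ x < f a, p (a, x) :=
  (hp.primrecRel.swap.exists_mem_list.comp (Primrec.list_range.comp hf) .id).of_eq fun a => by
    simp [Function.swap]

theorem primrec_sum_range {f : α → ℕ → ℕ} {n : α → ℕ} (hf : Primrec₂ f) (hn : Primrec n) :
    Primrec fun a => ∑ i ∈ Finset.range (n a), f a i := by
  refine (Primrec.nat_rec' hn (Primrec.const 0) (h := fun a p => p.2 + f a p.1)
    (Primrec.nat_add.comp (.comp .snd .snd) (hf.comp .fst (.comp .fst .snd)))).of_eq fun a => ?_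
  induction n a with
  | zero => rfl
  | succ n ih => rw [Finset.sum_range_succ, ← ih]

theorem primrec_card_filter_range {p : α → ℕ → Prop} [∀ a, DecidablePred (p a)] {n : α → ℕ}
    (hp : PrimrecRel p) (hn : Primrec n) :
    Primrec fun a => #{i ∈ Finset.range (n a) | p a i} :=
  (primrec_sum_range (f := fun a i => if p a i then 1 else 0)
    (Primrec.ite hp (.const 1) (.const 0)) hn).of_eq fun a => by
      rw [Finset.card_filter]

theorem primrec₂_pow : Primrec₂ fun m n : ℕ => m ^ n := Primrec₂.unpaired'.1 Nat.Primrec.pow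

theorem primrec_two_pow {f : α → ℕ} (hf : Primrec f) : Primrec fun a => 2 ^ f a :=
  primrec₂_pow.comp (.const 2) hf

theorem primrec₂_testBit : Primrec₂ Nat.testBit :=
  have bit_eq_one : PrimrecRel fun a i : ℕ => a / 2 ^ i % 2 = 1 :=
    Primrec.eq.comp (Primrec.nat_mod.comp (Primrec.nat_div.comp .fst (primrec_two_pow .snd))
      (.const 2)) (.const 1)
  bit_eq_one.decide.of_eq fun _ _ => Nat.testBit_eq_decide_div_mod_eq.symm

theorem primrecPred_testBit {f g : α → ℕ} (hf : Primrec f) (hg : Primrec g) :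
    PrimrecPred fun a => (f a).testBit (g a) :=
  Primrec.eq.comp (primrec₂_testBit.comp hf hg) (.const true)

theorem primrec_binaryValue : Primrec binaryValue :=
  Primrec.list_foldr .id (.const 0) <| Primrec.to₂ <| Primrec.cond (.comp .fst .snd)
    (Primrec.nat_double_succ.comp (.comp .snd .snd)) (Primrec.nat_double.comp (.comp .snd .snd))

end Primrec

/-- The colouring of the `N × N` grid by `M` colours whose rows are listed consecutively in `L`. -/
def tableColouring (N M : ℕ) (L : List ℕ) (x y : ℕ) : ℕ := L.getD (x * N + y) 0 % M

/-- The set of the numbers below `N` that are positions of ones in the binary expansion of `b`;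
every subset of `Finset.range N` arises from some `b < 2 ^ N`. -/
def bitSet (N b : ℕ) : Finset ℕ := {i ∈ Finset.range N | b.testBit i}

theorem bitSet_subset (N b : ℕ) : ↑(bitSet N b) ⊆ Set.Iio N := fun i hi => by
  simpa using (Finset.mem_filter.1 hi).1

theorem exists_bitSet_eq {N : ℕ} {s : Finset ℕ} (hs : ↑s ⊆ Set.Iio N) :
    ∃ b < 2 ^ N, bitSet N b = s := by
  refine ⟨binaryValue (initSeg (fun i => decide (i ∈ s)) N),
    (binaryValue_lt _).trans_eq (by rw [length_initSeg]), ?_⟩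
  ext i
  have := @hs i
  simp only [bitSet, Finset.mem_filter, Finset.mem_range, testBit_binaryValue, getD_initSeg]
  aesop

theorem isBalanced_Iio_iff_bitSet {N M K A T : ℕ} {E : ℕ → ℕ → ℕ} :
    IsBalanced (Set.Iio N) (Set.Iio N) (Set.Iio M) K A T E ↔
      ¬ ∃ b < 2 ^ N, ∃ b' < 2 ^ N, ∃ d < 2 ^ M, #(bitSet N b) ≤ K ∧ #(bitSet N b') ≤ K ∧
        #(bitSet M d) ≤ A ∧ T < #{p ∈ bitSet N b ×ˢ bitSet N b' | E p.1 p.2 ∈ bitSet M d} := by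
  push Not
  constructor
  · intro h b _ b' _ d _
    exact h _ _ _ (bitSet_subset _ _) (bitSet_subset _ _) (bitSet_subset _ _)
  · intro h s t a hs ht ha
    obtain ⟨b, hb, rfl⟩ := exists_bitSet_eq hs
    obtain ⟨b', hb', rfl⟩ := exists_bitSet_eq ht
    obtain ⟨d, hd, rfl⟩ := exists_bitSet_eq ha
    exact h b hb b' hb' d hd

theorem card_filter_bitSet_product (N M b b' d : ℕ) (E : ℕ → ℕ → ℕ) :
    #{p ∈ bitSet N b ×ˢ bitSet N b' | E p.1 p.2 ∈ bitSet M d}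
      = ∑ x ∈ Finset.range N, #{y ∈ Finset.range N | (b.testBit x ∧ b'.testBit y) ∧
          E x y < M ∧ d.testBit (E x y)} := by
  unfold bitSet
  rw [← Finset.filter_product, Finset.filter_filter, Finset.card_filter, Finset.sum_product]
  simp

theorem exists_isBalanced_tableColouring {N M K A j : ℕ} (hN : 0 < N) (hM : 0 < M)
    (hA : K * K * A ≤ j * M) (hj : N ^ K * N ^ K * 2 ^ M < 4 ^ j) :
    ∃ L, IsBalanced (Set.Iio N) (Set.Iio N) (Set.Iio M) K A (4 * j) (tableColouring N M L) := by
  have : NeZero N := ⟨hN.ne'⟩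
  have : NeZero M := ⟨hM.ne'⟩
  obtain ⟨E, hE⟩ := exists_isBalanced_univ (α := Fin N) (β := Fin N) (γ := Fin M) (K := K) (A := A)
    (j := j) (by simpa using hA) (by simpa using hj)
  refine ⟨(List.range (N * N)).map fun i => E (Fin.ofNat N (i / N)) (Fin.ofNat N (i % N)),
    hE.comap (f := Fin.ofNat N) (g := Fin.ofNat N) (k := Fin.ofNat M) (Set.mapsTo_univ _ _) ?_
      (Set.mapsTo_univ _ _) ?_ (Set.mapsTo_univ _ _) fun x hx y hy => ?_⟩
  iterate 2
    intro x hx y hy hxy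
    simpa [Fin.ext_iff, Nat.mod_eq_of_lt hx, Nat.mod_eq_of_lt hy] using hxy
  have index_lt : x * N + y < N * N := by
    rw [Set.mem_Iio] at hx hy
    nlinarith
  have div_eq : (x * N + y) / N = x := by
    rw [mul_comm, Nat.mul_add_div hN, Nat.div_eq_of_lt hy, add_zero]
  have mod_eq : (x * N + y) % N = y := by
    rw [mul_comm, Nat.mul_add_mod, Nat.mod_eq_of_lt hy]
  simp [tableColouring, List.getD_eq_getElem?_getD, index_lt, div_eq, mod_eq, Nat.mod_eq_of_lt]

section Search

variable {ι : Type*} [Primcodable ι] {N M K A T : ι → ℕ}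

theorem primrec_tableColouring {L : ι → List ℕ} {x y : ι → ℕ} (hN : Primrec N) (hM : Primrec M)
    (hL : Primrec L) (hx : Primrec x) (hy : Primrec y) :
    Primrec fun i => tableColouring (N i) (M i) (L i) (x i) (y i) :=
  Primrec.nat_mod.comp ((Primrec.list_getD 0).comp hL
    (Primrec.nat_add.comp (Primrec.nat_mul.comp hx hN) hy)) hM

theorem primrec_card_bitSet {b : ι → ℕ} (hN : Primrec N) (hb : Primrec b) :
    Primrec fun i => #(bitSet (N i) (b i)) :=
  primrec_card_filter_range (primrecPred_testBit (hb.comp .fst) .snd) hN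

theorem primrec_card_filter_bitSet_product {L : ι → List ℕ} {b b' d : ι → ℕ} (hN : Primrec N)
    (hM : Primrec M) (hL : Primrec L) (hb : Primrec b) (hb' : Primrec b') (hd : Primrec d) :
    Primrec fun i => #{p ∈ bitSet (N i) (b i) ×ˢ bitSet (N i) (b' i) |
      tableColouring (N i) (M i) (L i) p.1 p.2 ∈ bitSet (M i) (d i)} := by
  have i : Primrec fun q : (ι × ℕ) × ℕ => q.1.1 := .comp .fst .fst
  have colour := primrec_tableColouring (hN.comp i) (hM.comp i) (hL.comp i) (.comp .snd .fst) .snd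
  have mem : PrimrecRel fun (q : ι × ℕ) y => ((b q.1).testBit q.2 ∧ (b' q.1).testBit y) ∧
      tableColouring (N q.1) (M q.1) (L q.1) q.2 y < M q.1 ∧
        (d q.1).testBit (tableColouring (N q.1) (M q.1) (L q.1) q.2 y) :=
    ((primrecPred_testBit (hb.comp i) (.comp .snd .fst)).and
      (primrecPred_testBit (hb'.comp i) .snd)).and
      ((Primrec.nat_lt.comp colour (hM.comp i)).and (primrecPred_testBit (hd.comp i) colour))
  simp only [card_filter_bitSet_product]
  exact primrec_sum_range (primrec_card_filter_range mem (hN.comp .fst)) hN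

theorem primrecPred_isBalanced_tableColouring {L : ι → List ℕ} (hN : Primrec N) (hM : Primrec M)
    (hK : Primrec K) (hA : Primrec A) (hT : Primrec T) (hL : Primrec L) :
    PrimrecPred fun i => IsBalanced (Set.Iio (N i)) (Set.Iio (N i)) (Set.Iio (M i)) (K i) (A i)
      (T i) (tableColouring (N i) (M i) (L i)) := by
  simp only [isBalanced_Iio_iff_bitSet]
  have i : Primrec fun q : ((ι × ℕ) × ℕ) × ℕ => q.1.1.1 := .comp .fst (.comp .fst .fst)
  have b : Primrec fun q : ((ι × ℕ) × ℕ) × ℕ => q.1.1.2 := .comp .snd (.comp .fst .fst)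
  have b' : Primrec fun q : ((ι × ℕ) × ℕ) × ℕ => q.1.2 := .comp .snd .fst
  have d : Primrec fun q : ((ι × ℕ) × ℕ) × ℕ => q.2 := .snd
  have unbalanced := (Primrec.nat_le.comp (primrec_card_bitSet (hN.comp i) b) (hK.comp i)).and <|
    (Primrec.nat_le.comp (primrec_card_bitSet (hN.comp i) b') (hK.comp i)).and <|
    (Primrec.nat_le.comp (primrec_card_bitSet (hM.comp i) d) (hA.comp i)).and <|
    Primrec.nat_lt.comp (hT.comp i)
      (primrec_card_filter_bitSet_product (hN.comp i) (hM.comp i) (hL.comp i) b b' d)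
  exact (primrecPred_exists_lt (primrecPred_exists_lt (primrecPred_exists_lt unbalanced
    (primrec_two_pow (hM.comp (.comp .fst .fst)))) (primrec_two_pow (hN.comp .fst)))
    (primrec_two_pow hN)).not

theorem exists_computable_of_primrecRel {β : Type*} [Denumerable β] {R : ι → β → Prop}
    (hR : PrimrecRel R) (h : ∀ i, ∃ b, R i b) : ∃ f : ι → β, Computable f ∧ ∀ i, R i (f i) := by
  classical
  have hR' : ComputablePred fun q : ι × ℕ => R q.1 (Denumerable.ofNat β q.2) :=
    (hR.comp .fst ((Primrec.ofNat β).comp .snd)).computablePred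
  have h' (i : ι) : ∃ n, R i (Denumerable.ofNat β n) :=
    (h i).imp' Encodable.encode fun b hb => by rwa [Denumerable.ofNat_encode]
  exact ⟨fun i => Denumerable.ofNat β (Nat.find (h' i)),
    (Primrec.ofNat β).to_comp.comp (Computable.find hR' h'),
    fun i => Nat.find_spec (h' i)⟩

theorem exists_computable_isBalanced {j : ι → ℕ} (hN : Primrec N) (hM : Primrec M)
    (hK : Primrec K) (hA : Primrec A) (hj : Primrec j) (hN₀ : ∀ i, 0 < N i) (hM₀ : ∀ i, 0 < M i)
    (hKA : ∀ i, K i * K i * A i ≤ j i * M i)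
    (hNM : ∀ i, N i ^ K i * N i ^ K i * 2 ^ M i < 4 ^ j i) :
    ∃ E : ι → ℕ → ℕ → ℕ, Computable (fun q : ι × ℕ × ℕ => E q.1 q.2.1 q.2.2) ∧
      ∀ i, (∀ x y, E i x y < M i) ∧
        IsBalanced (Set.Iio (N i)) (Set.Iio (N i)) (Set.Iio (M i)) (K i) (A i) (4 * j i)
          (E i) := by
  obtain ⟨L, hL, hbal⟩ := exists_computable_of_primrecRel
    (primrecPred_isBalanced_tableColouring (hN.comp .fst) (hM.comp .fst) (hK.comp .fst)
      (hA.comp .fst) (Primrec.nat_mul.comp (.const 4) (hj.comp .fst)) .snd).primrecRel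
    fun i => exists_isBalanced_tableColouring (hN₀ i) (hM₀ i) (hKA i) (hNM i)
  have colour := primrec_tableColouring (L := fun r : (ι × List ℕ) × ℕ × ℕ => r.1.2)
    (hN.comp (.comp .fst .fst)) (hM.comp (.comp .fst .fst)) (.comp .snd .fst)
    (.comp .fst .snd) (.comp .snd .snd)
  exact ⟨fun i => tableColouring (N i) (M i) (L i), colour.to_comp.comp
    ((Computable.fst.pair (hL.comp .fst)).pair .snd),
    fun i => ⟨fun x y => Nat.mod_lt _ (hM₀ i), hbal i⟩⟩

theorem exists_computable_isBalanced_strings {n m k a e : ι → ℕ} (hn : Primrec n)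
    (hm : Primrec m) (hk : Primrec k) (ha : Primrec a) (he : Primrec e)
    (hka : ∀ i, 2 * k i + a i ≤ e i + m i) (hnm : ∀ i, 2 * n i * 2 ^ k i + 2 ^ m i < 2 * 2 ^ e i) :
    ∃ E : ι → List Bool → List Bool → List Bool,
      Computable (fun q : ι × List Bool × List Bool => E q.1 q.2.1 q.2.2) ∧
      ∀ i, (∀ x y, (E i x y).length = m i) ∧
        IsBalanced {x | x.length = n i} {y | y.length = n i} {w | w.length = m i}
          (2 ^ k i) (2 ^ a i) (4 * 2 ^ e i) (E i) := by
  obtain ⟨E, hE, hbal⟩ := exists_computable_isBalanced (primrec_two_pow hn) (primrec_two_pow hm)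
    (primrec_two_pow hk) (primrec_two_pow ha) (primrec_two_pow he) (fun i => by positivity)
    (fun i => by positivity)
    (fun i => by
      rw [← pow_add, ← pow_add, ← pow_add]
      exact Nat.pow_le_pow_right two_pos (by linarith [hka i]))
    (fun i => by
      rw [show 4 = 2 ^ 2 from rfl, ← pow_mul, ← pow_mul, ← pow_add, ← pow_add]
      exact Nat.pow_lt_pow_right one_lt_two (by linarith [hnm i]))
  have value {l : List Bool} {r : ℕ} (hl : l.length = r) : binaryValue l < 2 ^ r :=
    hl ▸ binaryValue_lt l
  refine ⟨fun i x y => initSeg (E i (binaryValue x) (binaryValue y)).testBit (m i), ?_,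
    fun i => ⟨fun x y => length_initSeg _ _, ?_⟩⟩
  · have bits : Primrec₂ fun v r : ℕ => initSeg v.testBit r := Primrec.list_map
      (Primrec.list_range.comp .snd) (primrec₂_testBit.comp (.comp .fst .fst) .snd).to₂
    exact bits.to_comp.comp (hE.comp (Computable.fst.pair
      ((primrec_binaryValue.to_comp.comp (.comp .fst .snd)).pair
        (primrec_binaryValue.to_comp.comp (.comp .snd .snd))))) (hm.to_comp.comp .fst)
  · exact (hbal i).2.comap (f := binaryValue) (g := binaryValue) (k := binaryValue)
      (fun _ => value) (injOn_binaryValue _) (fun _ => value) (injOn_binaryValue _)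
      (fun _ => value) fun x _ y _ => (binaryValue_initSeg_testBit ((hbal i).1 _ _)).symm

end Search

section RecursivelyEnumerable

variable {α β : Type*} [Primcodable α] [Primcodable β]

theorem exists_primrecRel_of_rePred {p : α → Prop} (hp : REPred p) :
    ∃ R : α → ℕ → Prop, PrimrecRel R ∧ ∀ a, p a ↔ ∃ n, R a n := by
  obtain ⟨c, hc⟩ := Nat.Partrec.Code.exists_code.1 hp
  refine ⟨fun a n => (c.evaln n (Encodable.encode a)).isSome, ?_, fun a => ?_⟩
  · exact Primrec.eq.comp (Primrec.option_isSome.comp (Nat.Partrec.Code.primrec_evaln.comp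
      (Primrec.pair (.pair .snd (.const c)) (Primrec.encode.comp .fst)))) (.const true)
  · have dom_iff : p a ↔ ∃ v, v ∈ c.eval (Encodable.encode a) := by
      rw [hc, ← Part.dom_iff_mem]
      simp [Part.assert]
    simp only [dom_iff, Nat.Partrec.Code.evaln_complete, Option.isSome_iff_exists, Option.mem_def]
    exact exists_comm

theorem exists_primrecRel_unique_of_rePred {p : α → Prop} (hp : REPred p) :
    ∃ R : α → ℕ → Prop, PrimrecRel R ∧ (∀ a, p a ↔ ∃ n, R a n) ∧
      ∀ a m n, R a m → R a n → m = n := by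
  classical
  obtain ⟨R, hR, hpR⟩ := exists_primrecRel_of_rePred hp
  have earlier : PrimrecPred fun q : α × ℕ => ∃ m < q.2, R q.1 m :=
    primrecPred_exists_lt (p := fun r : (α × ℕ) × ℕ => R r.1.1 r.2)
      (hR.comp (.comp .fst .fst) .snd) .snd
  refine ⟨fun a n => R a n ∧ ¬ ∃ m < n, R a m, hR.and earlier.not, fun a => ?_, ?_⟩
  · rw [hpR]
    exact ⟨fun h => ⟨Nat.find h, Nat.find_spec h, fun ⟨m, hm, hRm⟩ => Nat.find_min h hm hRm⟩,
      fun ⟨n, hn, _⟩ => ⟨n, hn⟩⟩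
  · rintro a m n ⟨hm, hm'⟩ ⟨hn, hn'⟩
    exact le_antisymm (not_lt.1 fun h => hm' ⟨n, h, hn⟩) (not_lt.1 fun h => hn' ⟨m, h, hm⟩)

theorem exists_primrec_injective_enumeration {p : α × β → Prop} (hp : REPred p) :
    ∃ g : α → ℕ → Option β, Primrec₂ g ∧ (∀ a b, p (a, b) ↔ ∃ s, g a s = some b) ∧
      ∀ a b s t, g a s = some b → g a t = some b → s = t := by
  classical
  obtain ⟨R, hR, hpR, huniq⟩ := exists_primrecRel_unique_of_rePred hp
  let g (a : α) (s : ℕ) : Option β :=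
    (Encodable.decode₂ (β × ℕ) s).bind fun q => if R (a, q.1) q.2 then some q.1 else none
  have g_eq_some {a : α} {s : ℕ} {b : β} :
      g a s = some b ↔ ∃ n, Encodable.encode (b, n) = s ∧ R (a, b) n := by
    simp [g, Option.bind_eq_some_iff, Encodable.decode₂_eq_some, and_comm]
  refine ⟨g, ?_, fun a b => ?_, fun a b s t hs ht => ?_⟩
  · exact Primrec.option_bind (Primrec.decode₂.comp .snd) (Primrec.ite
      (hR.comp (.pair (.comp .fst .fst) (.comp .fst .snd)) (.comp .snd .snd))
      (Primrec.option_some.comp (.comp .fst .snd)) (.const none)).to₂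
  · simp only [hpR, g_eq_some]
    exact ⟨fun ⟨n, hn⟩ => ⟨_, n, rfl, hn⟩, fun ⟨_, n, _, hn⟩ => ⟨n, hn⟩⟩
  · obtain ⟨m, rfl, hm⟩ := g_eq_some.1 hs
    obtain ⟨n, rfl, hn⟩ := g_eq_some.1 ht
    rw [huniq _ m n hm hn]

theorem rePred_exists {p : α × β → Prop} (hp : REPred p) : REPred fun a => ∃ b, p (a, b) := by
  obtain ⟨g, hg, hpg, -⟩ := exists_primrec_injective_enumeration hp
  exact (Partrec.rfindOpt hg.to_comp).dom_re.of_eq fun a => by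
    simp only [Nat.rfindOpt_dom, hpg, Option.mem_def]
    exact exists_comm

theorem rePred_and {p q : α → Prop} (hp : REPred p) (hq : REPred q) :
    REPred fun a => p a ∧ q a :=
  (hp.bind (hq.comp .fst).to₂).dom_re.of_eq fun a => by simp [Part.assert]

theorem rePred_mem {f : α →. β} (hf : Partrec f) : REPred fun q : α × β => q.2 ∈ f q.1 := by
  have eq : REPred fun r : (α × β) × β => r.2 = r.1.2 :=
    (ComputablePred.to_re (PrimrecPred.computablePred (Primrec.eq.comp .snd (.comp .snd .fst))))
  exact ((hf.comp .fst).bind eq.to₂).dom_re.of_eq fun q => by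
    simp [Part.assert, Part.mem_eq]

end RecursivelyEnumerable

theorem count_isSome_lt_card {β : Type*} {g : ℕ → Option β}
    (hg : ∀ b s t, g s = some b → g t = some b → s = t) {S : Finset β}
    (hS : ∀ b s, g s = some b → b ∈ S) {s : ℕ} (hs : (g s).isSome) :
    Nat.count (fun t => (g t).isSome) s < #S := by
  refine (Nat.count_strict_mono hs s.lt_succ_self).trans_le ?_
  rw [Nat.count_eq_card_filter_range]
  have isSome {t : ℕ} (ht : t ∈ {t ∈ Finset.range (s + 1) | (g t).isSome}) : (g t).isSome :=
    (Finset.mem_filter.1 ht).2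
  refine Finset.card_le_card_of_forall_subsingleton (fun t b => g t = some b)
    (fun t ht => ?_) fun b _ t ht t' ht' => hg b t t' ht.2 ht'.2
  obtain ⟨b, hb⟩ := Option.isSome_iff_exists.1 (isSome ht)
  exact ⟨b, hS b t hb, hb⟩

/-- The number `a` coded by a self-delimiting program `1ᵏ 0 α ι`, where `α` consists of `k` bits. -/
def programHeader (p : List Bool) : ℕ :=
  binaryValue ((p.drop (p.idxOf false + 1)).take (p.idxOf false))

/-- The number coded by the part `ι` of a self-delimiting program `1ᵏ 0 α ι`, where `α` consists of
`k` bits. -/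
def programPayload (p : List Bool) : ℕ :=
  binaryValue ((p.drop (p.idxOf false + 1)).drop (p.idxOf false))

theorem primrec_idxOf_false : Primrec fun p : List Bool => p.idxOf false :=
  Primrec.list_idxOf.comp (.const false) .id

theorem primrec_programHeader : Primrec programHeader :=
  primrec_binaryValue.comp (Primrec.list_take.comp primrec_idxOf_false
    (Primrec.list_drop.comp (Primrec.succ.comp primrec_idxOf_false) .id))

theorem primrec_programPayload : Primrec programPayload :=
  primrec_binaryValue.comp (Primrec.list_drop.comp primrec_idxOf_false
    (Primrec.list_drop.comp (Primrec.succ.comp primrec_idxOf_false) .id))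

theorem exists_programHeader_eq_programPayload_eq {h i k l : ℕ} (hh : h < 2 ^ k) (hi : i < 2 ^ l) :
    ∃ p : List Bool, programHeader p = h ∧ programPayload p = i ∧ p.length = 2 * k + 1 + l := by
  let p := List.replicate k true ++ false :: (initSeg h.testBit k ++ initSeg i.testBit l)
  have idxOf_eq : p.idxOf false = k := by
    rw [List.idxOf_append_of_notMem (by simp), List.idxOf_cons_self,
      List.length_replicate, add_zero]
  have drop_eq : p.drop (k + 1) = initSeg h.testBit k ++ initSeg i.testBit l := by
    simp [p, List.drop_append]
  refine ⟨p, ?_, ?_, ?_⟩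
  · rw [programHeader, idxOf_eq, drop_eq, List.take_left' (length_initSeg _ _),
      binaryValue_initSeg_testBit hh]
  · rw [programPayload, idxOf_eq, drop_eq, List.drop_left' (length_initSeg _ _),
      binaryValue_initSeg_testBit hi]
  · simp only [p, List.length_append, List.length_cons, List.length_replicate, length_initSeg]
    ring

theorem machineComplexity_lt_iff {M : Machine} {x : List Bool} {t : ℕ∞} :
    machineComplexity M x < t ↔ ∃ p, x ∈ M p ∧ (p.length : ℕ∞) < t := by
  simp [machineComplexity, iInf_lt_iff]

theorem exists_finset_mem_iff_length_lt (t : ℕ) :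
    ∃ S : Finset (List Bool), #S < 2 ^ t ∧ ∀ p, p ∈ S ↔ p.length < t := by
  let S := (Finset.range t).biUnion fun n =>
    (Finset.univ : Finset (List.Vector Bool n)).image List.Vector.toList
  have mem_S (p : List Bool) : p ∈ S ↔ p.length < t := by
    simp only [S, Finset.mem_biUnion, Finset.mem_range, Finset.mem_image, Finset.mem_univ, true_and]
    exact ⟨fun ⟨n, hn, v, hv⟩ => hv ▸ v.toList_length.trans_lt hn, fun h => ⟨_, h, ⟨p, rfl⟩, rfl⟩⟩
  refine ⟨S, ?_, mem_S⟩
  calc #S ≤ ∑ n ∈ Finset.range t, #(Finset.univ.image (List.Vector.toList (α := Bool) (n := n))) :=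
        Finset.card_biUnion_le
    _ ≤ ∑ n ∈ Finset.range t, 2 ^ n := Finset.sum_le_sum fun n _ =>
        Finset.card_image_le.trans_eq (by simp)
    _ < 2 ^ t := Nat.geomSum_lt le_rfl fun n hn => Finset.mem_range.1 hn

namespace IsUniversalMachine

variable {U : Machine}

theorem exists_plainK_le (hU : IsUniversalMachine U) {M : Machine} (hM : Partrec M) :
    ∃ c, ∀ p x, x ∈ M p → plainK U x ≤ p.length + c := by
  obtain ⟨c, hc⟩ := hU.2 M hM
  refine ⟨c, fun p x hx => ENat.toNat_le_of_le_natCast ((hc x).trans ?_)⟩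
  push_cast
  gcongr
  exact iInf₂_le p hx

theorem machineComplexity_ne_top (hU : IsUniversalMachine U) (x : List Bool) :
    machineComplexity U x ≠ ⊤ := by
  obtain ⟨c, hc⟩ := hU.2 (fun p => Part.some p) Computable.id
  have : machineComplexity (fun p => Part.some p) x < ⊤ :=
    machineComplexity_lt_iff.2 ⟨x, Part.mem_some x, ENat.natCast_lt_top _⟩
  exact ne_top_of_le_ne_top (WithTop.add_ne_top.2 ⟨this.ne, ENat.natCast_ne_top c⟩) (hc x)

theorem plainK_lt_iff (hU : IsUniversalMachine U) {x : List Bool} {t : ℕ} :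
    plainK U x < t ↔ ∃ p, x ∈ U p ∧ p.length < t := by
  have : (plainK U x : ℕ∞) = machineComplexity U x :=
    ENat.natCast_toNat (hU.machineComplexity_ne_top x)
  rw [← Nat.cast_lt (α := ℕ∞), this, machineComplexity_lt_iff]
  simp only [Nat.cast_lt]

theorem exists_finset_mem_iff_plainK_lt (hU : IsUniversalMachine U) (t : ℕ) :
    ∃ S : Finset (List Bool), #S < 2 ^ t ∧ ∀ x, x ∈ S ↔ plainK U x < t := by
  classical
  obtain ⟨P, hP, mem_P⟩ := exists_finset_mem_iff_length_lt t
  refine ⟨P.biUnion fun p => (U p).toOption.toFinset, lt_of_le_of_lt ?_ hP, fun x => ?_⟩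
  · refine (Finset.card_biUnion_le_card_mul _ _ 1 fun p _ => ?_).trans_eq (mul_one _)
    cases (U p).toOption <;> simp
  · simp [mem_P, hU.plainK_lt_iff, and_comm]

theorem exists_plainK_le_length (hU : IsUniversalMachine U) :
    ∃ c, ∀ x, plainK U x ≤ x.length + c := by
  obtain ⟨c, hc⟩ := hU.exists_plainK_le (M := fun p => Part.some p) Computable.id
  exact ⟨c, fun x => hc x x (Part.mem_some x)⟩

theorem exists_plainK_map_le (hU : IsUniversalMachine U) {f : List Bool → List Bool}
    (hf : Computable f) : ∃ c, ∀ x, plainK U (f x) ≤ plainK U x + c := by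
  obtain ⟨c, hc⟩ := hU.exists_plainK_le (hU.1.map (hf.comp .snd).to₂)
  refine ⟨c, fun x => ?_⟩
  obtain ⟨p, hp, hlen⟩ := hU.plainK_lt_iff.1 (plainK U x).lt_succ_self
  have := hc p (f x) (Part.mem_map f hp)
  omega

theorem rePred_plainK_lt (hU : IsUniversalMachine U) {α : Type*} [Primcodable α]
    {f : α → List Bool} {t : α → ℕ} (hf : Computable f) (ht : Computable t) :
    REPred fun a => plainK U (f a) < t a := by
  have program : REPred fun q : α × List Bool => f q.1 ∈ U q.2 :=
    (rePred_mem hU.1).comp (Computable.snd.pair (hf.comp .fst))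
  have short : ComputablePred fun q : α × List Bool => q.2.length < t q.1 := by
    refine ⟨inferInstance, ?_⟩
    exact Primrec.nat_lt.decide.to_comp.comp
      (Computable.list_length.comp .snd) (ht.comp .fst)
  simp only [hU.plainK_lt_iff]
  exact rePred_exists (rePred_and program short.to_re)

theorem exists_plainK_le_of_rePred (hU : IsUniversalMachine U) {α : Type*} [Primcodable α]
    {p : α × List Bool → Prop} (hp : REPred p) :
    ∃ d, ∀ (a : α) (S : Finset (List Bool)) (k l : ℕ), Encodable.encode a < 2 ^ k → #S ≤ 2 ^ l →
      (∀ w, p (a, w) → w ∈ S) → ∀ w, p (a, w) → plainK U w ≤ 2 * k + l + d := by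
  obtain ⟨g, hg, hpg, hinj⟩ := exists_primrec_injective_enumeration hp
  let rank (a : α) (s : ℕ) : ℕ := Nat.count (fun t => (g a t).isSome) s
  have hrank : Primrec₂ rank := by
    have isSome : PrimrecRel fun (q : α × ℕ) t => (g q.1 t).isSome = true :=
      Primrec.eq.comp (Primrec.option_isSome.comp (hg.comp (.comp .fst .fst) .snd)) (.const true)
    simp only [rank, Nat.count_eq_card_filter_range]
    exact primrec_card_filter_range isSome .snd
  let F (q : List Bool) (s : ℕ) : Option (List Bool) :=
    (Encodable.decode (α := α) (programHeader q)).bind fun a =>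
      if rank a s = programPayload q then g a s else none
  have hF : Primrec₂ F :=
    Primrec.option_bind (Primrec.decode.comp (primrec_programHeader.comp .fst)) (Primrec.ite
      (Primrec.eq.comp (hrank.comp .snd (.comp .snd .fst))
        (primrec_programPayload.comp (.comp .fst .fst)))
      (hg.comp .snd (.comp .snd .fst)) (.const none)).to₂
  obtain ⟨d, hd⟩ := hU.exists_plainK_le (Partrec.rfindOpt hF.to_comp)
  refine ⟨d + 1, fun a S k l ha hS hpS w hw => ?_⟩
  obtain ⟨s, hs⟩ := (hpg a w).1 hw
  have rank_lt : rank a s < 2 ^ l := (count_isSome_lt_card (hinj a)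
    (fun b t hb => hpS b ((hpg a b).2 ⟨t, hb⟩)) (Option.isSome_of_mem hs)).trans_le hS
  obtain ⟨q, hheader, hpayload, hlen⟩ := exists_programHeader_eq_programPayload_eq ha rank_lt
  have F_eq (t : ℕ) : F q t = if rank a t = rank a s then g a t else none := by
    simp only [F, hheader, hpayload, Encodable.encodek, Option.bind_some]
  have hmem : w ∈ Nat.rfindOpt (F q) := by
    have hdom : (Nat.rfindOpt (F q)).Dom := Nat.rfindOpt_dom.2 ⟨s, w, by simp [F_eq, hs]⟩
    obtain ⟨t, ht⟩ := Nat.rfindOpt_spec (Part.get_mem hdom)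
    rw [Option.mem_def, F_eq, Option.ite_none_right_eq_some] at ht
    have : t = s := Nat.count_injective (p := fun t => (g a t).isSome)
      (Option.isSome_of_mem ht.2) (Option.isSome_of_mem hs) ht.1
    subst this
    rw [← Option.some.inj (ht.2.symm.trans hs)]
    exact Part.get_mem hdom
  have := hd q w hmem
  omega

end IsUniversalMachine

/-- Computable colourings `E u` of the pairs of strings of length `2 ^ u` by strings of length
`m * u`, such that for sets of `2 ^ ((m + 1) * u)` strings on either side and a set of
`2 ^ (a * u)` colours, the number of pairs so coloured exceeds its average `2 ^ ((m + 2 + a) * u)`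
by at most a factor of `16`. -/
structure IsExtractorFamily (m a : ℕ) (E : ℕ → List Bool → List Bool → List Bool) : Prop where
  computable : Computable fun q : ℕ × List Bool × List Bool => E q.1 q.2.1 q.2.2
  length_eq : ∀ u x y, (E u x y).length = m * u
  isBalanced : ∀ u, IsBalanced {x | x.length = 2 ^ u} {y | y.length = 2 ^ u}
    {w | w.length = m * u} (2 ^ ((m + 1) * u)) (2 ^ (a * u)) (2 ^ ((m + 2 + a) * u + 4)) (E u)

theorem IsExtractorFamily.computable_comp {m a : ℕ} {E : ℕ → List Bool → List Bool → List Bool}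
    (hE : IsExtractorFamily m a E) {α : Type*} [Primcodable α] {u : α → ℕ} {x y : α → List Bool}
    (hu : Computable u) (hx : Computable x) (hy : Computable y) :
    Computable fun b => E (u b) (x b) (y b) :=
  hE.computable.comp (hu.pair (hx.pair hy))

theorem exists_isExtractorFamily (m a : ℕ) : ∃ E, IsExtractorFamily m a E := by
  have linear (b : ℕ) : Primrec fun u => b * u := Primrec.nat_mul.comp (.const b) .id
  obtain ⟨E, hE, h⟩ := exists_computable_isBalanced_strings
    (n := fun u => 2 ^ u) (m := fun u => m * u) (k := fun u => (m + 1) * u) (a := fun u => a * u)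
    (e := fun u => (m + 2 + a) * u + 2) (primrec_two_pow .id) (linear m) (linear (m + 1)) (linear a)
    (Primrec.nat_add.comp (linear (m + 2 + a)) (.const 2)) (fun u => by ring_nf; omega) fun u => by
      have h₁ : 2 * 2 ^ u * 2 ^ ((m + 1) * u) = 2 ^ ((m + 2) * u + 1) := by ring
      have h₂ : 2 ^ (m * u) ≤ 2 ^ ((m + 2) * u + 1) := by gcongr <;> grind
      have h₃ : 2 ^ ((m + 2) * u + 1) ≤ 2 ^ ((m + 2 + a) * u + 1) :=
        Nat.pow_le_pow_right two_pos
          (Nat.succ_le_succ (Nat.mul_le_mul_right u (Nat.le_add_right (m + 2) a)))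
      have h₄ : 2 * 2 ^ ((m + 2 + a) * u + 2) = 4 * 2 ^ ((m + 2 + a) * u + 1) := by ring
      have : 0 < 2 ^ ((m + 2 + a) * u + 1) := by positivity
      omega
  refine ⟨E, hE, fun u => (h u).1, fun u => ?_⟩
  convert (h u).2 using 1
  ring

theorem exists_finset_append_mem_of_isBalanced {U : Machine} (hU : IsUniversalMachine U)
    {n m k a T t₁ t₂ : ℕ} {E : List Bool → List Bool → List Bool}
    (hlen : ∀ x y, (E x y).length = m)
    (hE : IsBalanced {x | x.length = n} {y | y.length = n} {w | w.length = m} (2 ^ k) (2 ^ a)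
      (2 ^ T) E) (h₁ : k ≤ t₁) (h₂ : k ≤ t₂) :
    ∃ S : Finset (List Bool), #S ≤ 2 ^ (t₁ - k + (t₂ - k) + T) ∧ ∀ x y, x.length = n →
      y.length = n → plainK U x < t₁ → plainK U y < t₂ → plainK U (E x y) < a → x ++ y ∈ S := by
  have simple (t r : ℕ) : ∃ s : Finset (List Bool), #s ≤ 2 ^ t ∧
      (s : Set (List Bool)) ⊆ {x | x.length = r} ∧
        ∀ x : List Bool, x.length = r → plainK U x < t → x ∈ s := by
    obtain ⟨s, hs, mem_s⟩ := hU.exists_finset_mem_iff_plainK_lt t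
    exact ⟨{x ∈ s | x.length = r}, (Finset.card_filter_le _ _).trans hs.le,
      fun x hx => (Finset.mem_filter.1 hx).2,
      fun x hx ht => Finset.mem_filter.2 ⟨(mem_s x).2 ht, hx⟩⟩
  have split {t : ℕ} (ht : k ≤ t) : 2 ^ t = 2 ^ (t - k) * 2 ^ k := by
    rw [← pow_add, Nat.sub_add_cancel ht]
  obtain ⟨X, hXcard, hXlen, mem_X⟩ := simple t₁ n
  obtain ⟨Y, hYcard, hYlen, mem_Y⟩ := simple t₂ n
  obtain ⟨A, hAcard, hAlen, mem_A⟩ := simple a m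
  have hcard := hE.card_filter_le_mul hXlen hYlen hAlen hAcard (hXcard.trans_eq (split h₁))
    (hYcard.trans_eq (split h₂))
  refine ⟨{p ∈ X ×ˢ Y | E p.1 p.2 ∈ A}.image fun p => p.1 ++ p.2,
    (Finset.card_image_le.trans hcard).trans_eq (by ring), fun x y hx hy hxt hyt hEa => ?_⟩
  exact Finset.mem_image.2 ⟨(x, y), Finset.mem_filter.2 ⟨Finset.mem_product.2
    ⟨mem_X x hx hxt, mem_Y y hy hyt⟩, mem_A _ (hlen x y) hEa⟩, rfl⟩

theorem IsExtractorFamily.rePred_exists_append_eq {U : Machine} (hU : IsUniversalMachine U)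
    {m a : ℕ} {E : ℕ → List Bool → List Bool → List Bool} (hE : IsExtractorFamily m a E) :
    REPred fun q : (ℕ × ℕ × ℕ) × List Bool => ∃ p : List Bool × List Bool,
      (p.1.length = 2 ^ q.1.1 ∧ p.2.length = 2 ^ q.1.1 ∧ p.1 ++ p.2 = q.2) ∧
        plainK U p.1 < q.1.2.1 ∧ plainK U p.2 < q.1.2.2 ∧
          plainK U (E q.1.1 p.1 p.2) < a * q.1.1 := by
  let Q := ((ℕ × ℕ × ℕ) × List Bool) × List Bool × List Bool
  have u : Primrec fun q : Q => q.1.1.1 := .comp .fst (.comp .fst .fst)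
  have t₁ : Primrec fun q : Q => q.1.1.2.1 := .comp .fst (.comp .snd (.comp .fst .fst))
  have t₂ : Primrec fun q : Q => q.1.1.2.2 := .comp .snd (.comp .snd (.comp .fst .fst))
  have x : Primrec fun q : Q => q.2.1 := .comp .fst .snd
  have y : Primrec fun q : Q => q.2.2 := .comp .snd .snd
  have shape : PrimrecPred fun q : Q =>
      q.2.1.length = 2 ^ q.1.1.1 ∧ q.2.2.length = 2 ^ q.1.1.1 ∧ q.2.1 ++ q.2.2 = q.1.2 :=
    (Primrec.eq.comp (Primrec.list_length.comp x) (primrec_two_pow u)).and <|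
      (Primrec.eq.comp (Primrec.list_length.comp y) (primrec_two_pow u)).and <|
        Primrec.eq.comp (Primrec.list_append.comp x y) (.comp .snd .fst)
  have hx : REPred fun q : Q => plainK U q.2.1 < q.1.1.2.1 :=
    hU.rePred_plainK_lt x.to_comp t₁.to_comp
  have hy : REPred fun q : Q => plainK U q.2.2 < q.1.1.2.2 :=
    hU.rePred_plainK_lt y.to_comp t₂.to_comp
  have colour : Computable fun q : Q => E q.1.1.1 q.2.1 q.2.2 :=
    hE.computable_comp u.to_comp x.to_comp y.to_comp
  have hxy : REPred fun q : Q => plainK U (E q.1.1.1 q.2.1 q.2.2) < a * q.1.1.1 :=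
    hU.rePred_plainK_lt colour (Primrec.nat_mul.comp (.const a) u).to_comp
  exact rePred_exists (rePred_and shape.computablePred.to_re (rePred_and hx (rePred_and hy hxy)))

theorem IsExtractorFamily.exists_plainK_append_le {U : Machine} (hU : IsUniversalMachine U)
    {m a : ℕ} {E : ℕ → List Bool → List Bool → List Bool} (hE : IsExtractorFamily m a E) :
    ∃ d, ∀ (u t₁ t₂ h : ℕ) (x y : List Bool), x.length = 2 ^ u → y.length = 2 ^ u →
      plainK U x < t₁ → plainK U y < t₂ → plainK U (E u x y) < a * u →
      (m + 1) * u ≤ t₁ → (m + 1) * u ≤ t₂ → Nat.pair u (Nat.pair t₁ t₂) < 2 ^ h →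
      plainK U (x ++ y) + m * u ≤ t₁ + t₂ + a * u + 2 * h + d := by
  obtain ⟨d, hd⟩ := hU.exists_plainK_le_of_rePred (hE.rePred_exists_append_eq hU)
  refine ⟨d + 4, fun u t₁ t₂ h x y hx hy hxt hyt hxy h₁ h₂ hh => ?_⟩
  obtain ⟨S, hS, mem_S⟩ := exists_finset_append_mem_of_isBalanced hU (hE.length_eq u)
    (hE.isBalanced u) h₁ h₂
  have key : plainK U (x ++ y) ≤ 2 * h + (t₁ - (m + 1) * u + (t₂ - (m + 1) * u)
      + ((m + 2 + a) * u + 4)) + d := by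
    refine hd (u, t₁, t₂) S h _ hh hS ?_ _ ⟨(x, y), ⟨hx, hy, rfl⟩, hxt, hyt, hxy⟩
    rintro _ ⟨⟨x, y⟩, ⟨hx, hy, rfl⟩, hxt, hyt, hxy⟩
    exact mem_S x y hx hy hxt hyt hxy
  have : (m + 2 + a) * u + m * u = 2 * ((m + 1) * u) + a * u := by ring
  omega

theorem pair_pair_lt_two_pow {u t₁ t₂ : ℕ} (h₁ : t₁ ≤ 2 ^ (u + 1)) (h₂ : t₂ ≤ 2 ^ (u + 1)) :
    Nat.pair u (Nat.pair t₁ t₂) < 2 ^ (4 * u + 8) := by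
  have pair_lt {s t k : ℕ} (hs : s < 2 ^ k) (ht : t < 2 ^ k) : Nat.pair s t < 2 ^ (k * 2) := by
    rw [pow_mul]
    exact (Nat.pair_lt_max_add_one_sq s t).trans_le (Nat.pow_le_pow_left (max_lt hs ht) 2)
  have hlt : 2 ^ (u + 1) < 2 ^ (u + 2) := Nat.pow_lt_pow_succ one_lt_two
  have hu : u < 2 ^ ((u + 2) * 2) :=
    Nat.lt_two_pow_self.trans (Nat.pow_lt_pow_right one_lt_two (by omega))
  exact (pair_lt hu (pair_lt (h₁.trans_lt hlt) (h₂.trans_lt hlt))).trans_eq (by ring)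

theorem IsExtractorFamily.eventually_le_plainK {U : Machine} (hU : IsUniversalMachine U) {m a : ℕ}
    {E : ℕ → List Bool → List Bool → List Bool} (hE : IsExtractorFamily m a E) {c : ℝ}
    (hm : 2 * c + 9 + a ≤ m) {x y : BinSeq} (hxy : IndependentWith U c x y)
    (hx : ∀ᶠ n : ℕ in atTop, (m + 1) * Real.logb 2 n < plainK U (initSeg x n))
    (hy : ∀ᶠ n : ℕ in atTop, (m + 1) * Real.logb 2 n < plainK U (initSeg y n)) :
    ∀ᶠ u in atTop, a * u ≤ plainK U (E u (initSeg x (2 ^ u)) (initSeg y (2 ^ u))) := by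
  obtain ⟨c₀, hc₀⟩ := hU.exists_plainK_le_length
  obtain ⟨d, hd⟩ := hE.exists_plainK_append_le hU
  obtain ⟨d', hd'⟩ := hxy
  have logb_two_pow (u : ℕ) : Real.logb 2 (2 ^ u : ℕ) = u := by simp [Real.logb_pow]
  have hpow : Tendsto (fun u : ℕ => 2 ^ u) atTop atTop :=
    tendsto_pow_atTop_atTop_of_one_lt one_lt_two
  filter_upwards [hpow.eventually hx, hpow.eventually hy, hpow.eventually_gt_atTop c₀,
    tendsto_natCast_atTop_atTop.eventually_gt_atTop (18 + d + d')] with u hxu hyu hc₀u hu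
  by_contra! hcon
  have le_two_pow (w : BinSeq) : plainK U (initSeg w (2 ^ u)) + 1 ≤ 2 ^ (u + 1) := by
    have := hc₀ (initSeg w (2 ^ u))
    rw [length_initSeg] at this
    omega
  have mul_le {w : BinSeq}
      (hw : (m + 1) * Real.logb 2 (2 ^ u : ℕ) < plainK U (initSeg w (2 ^ u))) :
      (m + 1) * u ≤ plainK U (initSeg w (2 ^ u)) + 1 := by
    rw [logb_two_pow] at hw
    exact_mod_cast hw.le.trans (lt_add_one _).le
  have upper : plainK U (initSeg x (2 ^ u) ++ initSeg y (2 ^ u)) + (m * u : ℝ) ≤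
      plainK U (initSeg x (2 ^ u)) + 1 + (plainK U (initSeg y (2 ^ u)) + 1) + a * u
        + 2 * (4 * u + 8) + d := by
    exact_mod_cast hd u _ _ _ _ _ (length_initSeg _ _) (length_initSeg _ _) (Nat.lt_succ_self _)
      (Nat.lt_succ_self _) hcon (mul_le hxu) (mul_le hyu)
      (pair_pair_lt_two_pow (le_two_pow x) (le_two_pow y))
  have lower := hd' (2 ^ u) (2 ^ u) Nat.one_le_two_pow Nat.one_le_two_pow
  rw [logb_two_pow] at lower
  have : (2 * c + 9 + a) * (u : ℝ) ≤ m * u := by gcongr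
  linarith

theorem OracleComputable.of_partrec {f : ℕ →. ℕ} (hf : Nat.Partrec f) :
    OracleComputable fun _ _ => f := by
  induction hf with
  | zero => exact .zero
  | succ => exact .succ
  | left => exact .left
  | right => exact .right
  | pair _ _ hf hg => exact .pair hf hg
  | comp _ _ hf hg => exact .comp hf hg
  | prec _ _ hf hg => exact .prec hf hg
  | rfind _ hf => exact .rfind hf

/-- The total functions computed by machines with two oracles, uniformly in the oracle sequences;
values are represented by their `Primcodable` encodings. -/
def OracleComputableFun {α : Type*} [Primcodable α] (f : BinSeq → BinSeq → ℕ → α) : Prop :=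
  OracleComputable fun x y n => Part.some (Encodable.encode (f x y n))

theorem isTruthTableReduction_iff_oracleComputableFun {f : BinSeq → BinSeq → BinSeq} :
    IsTruthTableReduction f ↔ OracleComputableFun f := by
  have encode_eq_toNat (b : Bool) : Encodable.encode b = b.toNat := by cases b <;> rfl
  simp only [IsTruthTableReduction, OracleComputableFun, encode_eq_toNat]

namespace OracleComputableFun

variable {α β : Type*} [Primcodable α] [Primcodable β] {f : BinSeq → BinSeq → ℕ → α}

theorem of_computable {g : ℕ → α} (hg : Computable g) : OracleComputableFun fun _ _ => g :=
  OracleComputable.of_partrec (Partrec.nat_iff.1 (Computable.encode.comp hg))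

theorem map (hf : OracleComputableFun f) {g : α → β} (hg : Computable g) :
    OracleComputableFun fun x y n => g (f x y n) := by
  have h := (OracleComputable.of_partrec hg).comp hf
  simpa [OracleComputableFun] using h

theorem comp_computable (hf : OracleComputableFun f) {n : ℕ → ℕ} (hn : Computable n) :
    OracleComputableFun fun x y p => f x y (n p) := by
  have h := OracleComputable.comp hf (of_computable hn)
  simpa [OracleComputableFun] using h

theorem pair (hf : OracleComputableFun f) {g : BinSeq → BinSeq → ℕ → β}
    (hg : OracleComputableFun g) : OracleComputableFun fun x y n => (f x y n, g x y n) := by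
  have h := OracleComputable.pair hf hg
  simpa [OracleComputableFun, Seq.seq] using h

end OracleComputableFun

theorem oracleComputableFun_initSeg {q : BinSeq → BinSeq → BinSeq} (hq : OracleComputableFun q) :
    OracleComputableFun fun x y n => initSeg (q x y) n := by
  let decodeList (i : ℕ) : List Bool := (Encodable.decode i).getD []
  have accumulated : Primrec fun m : ℕ => decodeList m.unpair.2.unpair.2 :=
    Primrec.option_getD.comp (Primrec.decode.comp (.comp .snd (.comp .unpair (.comp .snd .unpair))))
      (.const [])
  have index : Primrec fun m : ℕ => m.unpair.2.unpair.1 :=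
    .comp .fst (.comp .unpair (.comp .snd .unpair))
  have append_bit : Primrec fun p : List Bool × Bool => p.1 ++ [p.2] := Primrec.list_concat
  have step : OracleComputableFun fun x y m =>
      decodeList m.unpair.2.unpair.2 ++ [q x y m.unpair.2.unpair.1] :=
    ((OracleComputableFun.of_computable accumulated.to_comp).pair
      (hq.comp_computable index.to_comp)).map append_bit.to_comp
  have run (x y : BinSeq) (n : ℕ) :
      Nat.rec (motive := fun _ => Part ℕ) (Part.some (Encodable.encode ([] : List Bool)))
        (fun k code => code.bind fun i =>
          Part.some (Encodable.encode (decodeList i ++ [q x y k]))) n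
        = Part.some (Encodable.encode (initSeg (q x y) n)) := by
    induction n with
    | zero => rfl
    | succ n ih =>
      simp only [ih, Part.bind_some]
      simp [decodeList, initSeg, List.range_succ]
  have start : OracleComputableFun fun _ _ _ => ([] : List Bool) := .of_computable (.const [])
  have input : OracleComputableFun fun _ _ n => Nat.pair 0 n :=
    .of_computable (Primrec₂.natPair.comp (.const 0) .id).to_comp
  have h := (OracleComputable.prec start step).comp input
  simpa only [OracleComputableFun, Encodable.encode_nat, Part.bind_eq_bind, Part.bind_some,
    Nat.unpaired, Nat.unpair_pair, run] using h

theorem isTruthTableReduction_of_initSeg {g : ℕ → List Bool → List Bool → Bool} {n : ℕ → ℕ}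
    (hg : Computable fun q : ℕ × List Bool × List Bool => g q.1 q.2.1 q.2.2) (hn : Computable n) :
    IsTruthTableReduction fun x y p => g p (initSeg x (n p)) (initSeg y (n p)) := by
  have fst_oracle : OracleComputableFun fun x _ => x :=
    isTruthTableReduction_iff_oracleComputableFun.1 .queryFirst
  have snd_oracle : OracleComputableFun fun _ y => y :=
    isTruthTableReduction_iff_oracleComputableFun.1 .querySecond
  rw [isTruthTableReduction_iff_oracleComputableFun]
  exact ((OracleComputableFun.of_computable .id).pair
    (((oracleComputableFun_initSeg fst_oracle).comp_computable hn).pair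
      ((oracleComputableFun_initSeg snd_oracle).comp_computable hn))).map hg

theorem primrec_log (b : ℕ) : Primrec (Nat.log b) := by
  rcases le_or_gt b 1 with hb | hb
  · exact (Primrec.const 0).of_eq fun n => (Nat.log_of_left_le_one hb n).symm
  have le : PrimrecRel fun n i : ℕ => b ^ i ≤ n :=
    Primrec.nat_le.comp (primrec₂_pow.comp (.const b) .snd) .fst
  refine (Primrec.nat_findGreatest .id le).of_eq fun n => Nat.findGreatest_eq_iff.2
    ⟨Nat.log_le_self b n, fun hn => Nat.pow_log_le_self b ?_, fun {i} hi _ => ?_⟩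
  · rintro rfl
    simp at hn
  · exact Nat.not_le.2 (Nat.lt_pow_of_log_lt hb hi)

theorem primrecPred_mem_range_of_strictMono {f : ℕ → ℕ} (hf : Primrec f) (hmono : StrictMono f) :
    PrimrecPred fun n => n ∈ Set.range f := by
  have eq : PrimrecPred fun q : ℕ × ℕ => f q.2 = q.1 := Primrec.eq.comp (hf.comp .snd) .fst
  refine (primrecPred_exists_lt eq .succ).of_eq fun n => ⟨fun ⟨j, _, hj⟩ => ⟨j, hj⟩, ?_⟩
  rintro ⟨j, rfl⟩
  exact ⟨j, Nat.lt_succ_of_le (hmono.id_le j), rfl⟩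

theorem exists_infinite_computablePred_of_eventually {f : ℕ → ℕ} (hf : Primrec f)
    (hmono : StrictMono f) {p : ℕ → Prop} (hp : ∀ᶠ j in atTop, p (f j)) :
    ∃ S : Set ℕ, S.Infinite ∧ ComputablePred (fun n => n ∈ S) ∧ ∀ n ∈ S, p n := by
  obtain ⟨j₀, hj₀⟩ := eventually_atTop.1 hp
  have shift_mono : StrictMono fun j => f (j + j₀) := hmono.comp (strictMono_id.add_const j₀)
  have shift_primrec : Primrec fun j => f (j + j₀) := hf.comp (Primrec.nat_add.comp .id (.const j₀))
  exact ⟨Set.range fun j => f (j + j₀), Set.infinite_range_of_injective shift_mono.injective,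
    (primrecPred_mem_range_of_strictMono shift_primrec shift_mono).computablePred,
    Set.forall_mem_range.2 fun j => hj₀ (j + j₀) (Nat.le_add_left _ _)⟩

/-- The sequence whose block at the positions from `s * L ^ j` to `s * L ^ (j + 1)` is the colour,
under the `L ^ j`-th colouring, of the initial segments of `x` and `y` of length `2 ^ L ^ j`. -/
def blockSeq (s L : ℕ) (E : ℕ → List Bool → List Bool → List Bool) (x y : BinSeq) : BinSeq :=
  fun p =>
    let u := L ^ Nat.log L (p / s)
    (E u (initSeg x (2 ^ u)) (initSeg y (2 ^ u))).getD (p - s * u) false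

theorem drop_initSeg_blockSeq {s l : ℕ} {E : ℕ → List Bool → List Bool → List Bool}
    (hE : ∀ u x y, (E u x y).length = s * l * u) (x y : BinSeq) (j : ℕ) :
    (initSeg (blockSeq s (l + 1) E x y) (s * (l + 1) ^ (j + 1))).drop (s * (l + 1) ^ j) =
      E ((l + 1) ^ j) (initSeg x (2 ^ (l + 1) ^ j)) (initSeg y (2 ^ (l + 1) ^ j)) := by
  set u := (l + 1) ^ j with hu
  have hsucc : s * (l + 1) ^ (j + 1) = s * u + s * l * u := by rw [pow_succ, ← hu]; ring
  refine List.ext_getElem (by simp [hE, hsucc, length_initSeg]) fun i _ hi => ?_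
  rw [hE] at hi
  have hs : 0 < s := Nat.pos_of_ne_zero fun h => by simp [h] at hi
  have log_eq : Nat.log (l + 1) ((s * u + i) / s) = j := by
    refine Nat.log_eq_of_pow_le_of_lt_pow ?_ ?_
    · rw [Nat.le_div_iff_mul_le hs, mul_comm, ← hu]
      exact Nat.le_add_right _ _
    · rw [Nat.div_lt_iff_lt_mul hs, mul_comm _ s, hsucc]
      exact Nat.add_lt_add_left hi _
  simp [initSeg, blockSeq, log_eq, ← hu, hE, hi]

theorem IsExtractorFamily.isTruthTableReduction_blockSeq {m a : ℕ}
    {E : ℕ → List Bool → List Bool → List Bool} (hE : IsExtractorFamily m a E) (s L : ℕ) :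
    IsTruthTableReduction (blockSeq s L E) := by
  have u : Primrec fun p => L ^ Nat.log L (p / s) := primrec₂_pow.comp (.const L)
    ((primrec_log L).comp (Primrec.nat_div.comp .id (.const s)))
  have u' : Primrec fun q : ℕ × List Bool × List Bool => L ^ Nat.log L (q.1 / s) := u.comp .fst
  have offset : Primrec fun q : ℕ × List Bool × List Bool => q.1 - s * L ^ Nat.log L (q.1 / s) :=
    Primrec.nat_sub.comp .fst (Primrec.nat_mul.comp (.const s) u')
  have colour := hE.computable_comp u'.to_comp (.comp .fst .snd) (.comp .snd .snd)
  exact isTruthTableReduction_of_initSeg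
    (g := fun p x y => (E (L ^ Nat.log L (p / s)) x y).getD (p - s * L ^ Nat.log L (p / s)) false)
    ((Primrec.list_getD false).to_comp.comp colour offset.to_comp) (primrec_two_pow u).to_comp

theorem IsExtractorFamily.eventually_lt_plainK_blockSeq {U : Machine} (hU : IsUniversalMachine U)
    {s l : ℕ} {E : ℕ → List Bool → List Bool → List Bool}
    (hE : IsExtractorFamily (s * (l + 1)) (s * l) E) (hs : 0 < s) {c δ : ℝ} (hc : 2 * c + 9 ≤ s)
    (hδ : 3 ≤ δ * (l + 2)) {x y : BinSeq} (hxy : IndependentWith U c x y)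
    (hx : ∀ᶠ n : ℕ in atTop, ((s * (l + 1) : ℕ) + 1) * Real.logb 2 n < plainK U (initSeg x n))
    (hy : ∀ᶠ n : ℕ in atTop, ((s * (l + 1) : ℕ) + 1) * Real.logb 2 n < plainK U (initSeg y n)) :
    ∀ᶠ j in atTop, (1 - δ) * (s * (l + 2) ^ (j + 1) : ℕ) <
      plainK U (initSeg (blockSeq s (l + 2) E x y) (s * (l + 2) ^ (j + 1))) := by
  have last_block : Computable fun z : List Bool => z.drop (z.length / (l + 2)) :=
    (Primrec.list_drop.comp (Primrec.nat_div.comp .list_length (.const (l + 2))) .id).to_comp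
  obtain ⟨c', hc'⟩ := hU.exists_plainK_map_le last_block
  have hpow : Tendsto (fun j : ℕ => (l + 2) ^ j) atTop atTop :=
    tendsto_pow_atTop_atTop_of_one_lt (by omega)
  have hm : 2 * c + 9 + (s * l : ℕ) ≤ (s * (l + 1) : ℕ) := by push_cast; linarith
  filter_upwards [hpow.eventually (hE.eventually_le_plainK hU hm hxy hx hy),
    hpow.eventually_gt_atTop c'] with j hblock hj
  set z := initSeg (blockSeq s (l + 2) E x y) (s * (l + 2) ^ (j + 1))
  have hdrop : z.length / (l + 2) = s * (l + 2) ^ j := by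
    rw [length_initSeg, pow_succ, ← mul_assoc, Nat.mul_div_cancel _ (by omega)]
  have block : z.drop (s * (l + 2) ^ j) = E ((l + 2) ^ j) (initSeg x (2 ^ (l + 2) ^ j))
      (initSeg y (2 ^ (l + 2) ^ j)) := drop_initSeg_blockSeq hE.length_eq x y j
  have key : s * l * (l + 2) ^ j < plainK U z + s * (l + 2) ^ j := by
    have := hc' z
    rw [hdrop, block] at this
    have := Nat.le_mul_of_pos_left ((l + 2) ^ j) hs
    omega
  have hδ' : 3 * (s * (l + 2 : ℝ) ^ j) ≤ δ * (l + 2) * (s * (l + 2) ^ j) := by gcongr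
  have key' : (s * l * (l + 2) ^ j : ℝ) < plainK U z + s * (l + 2) ^ j := by exact_mod_cast key
  push_cast
  rw [pow_succ]
  linarith

theorem mainTheorem4 (U : Machine) (hU : IsUniversalMachine U) (δ : ℝ) (hδ : 0 < δ) (c : ℝ) :
    ∃ (C : ℝ) (f : BinSeq → BinSeq → BinSeq), IsTruthTableReduction f ∧
      ∀ x y : BinSeq, IndependentWith U c x y →
        (∀ᶠ n : ℕ in atTop, C * Real.logb 2 n < (plainK U (initSeg x n) : ℝ)) →
        (∀ᶠ n : ℕ in atTop, C * Real.logb 2 n < (plainK U (initSeg y n) : ℝ)) →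
        (∃ᶠ n : ℕ in atTop, (1 - δ) * (n : ℝ) < (plainK U (initSeg (f x y) n) : ℝ)) ∧
        ∃ S : Set ℕ, S.Infinite ∧ ComputablePred (fun n : ℕ => n ∈ S) ∧
          ∀ n ∈ S, (1 - δ) * (n : ℝ) < (plainK U (initSeg (f x y) n) : ℝ) := by
  obtain ⟨l, hl⟩ := exists_nat_ge (3 / δ)
  have hδl : 3 ≤ δ * (l + 2) := by
    rw [div_le_iff₀' hδ] at hl
    linarith
  obtain ⟨s, hs⟩ := exists_nat_ge (max 1 (2 * c + 9))
  have hs₀ : 0 < s := by exact_mod_cast (le_max_left _ _).trans hs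
  obtain ⟨E, hE⟩ := exists_isExtractorFamily (s * (l + 1)) (s * l)
  refine ⟨(s * (l + 1) : ℕ) + 1, blockSeq s (l + 2) E, hE.isTruthTableReduction_blockSeq s (l + 2),
    fun x y hxy hx hy => ?_⟩
  have block_ends_mono : StrictMono fun j => s * (l + 2) ^ (j + 1) := fun i j hij =>
    Nat.mul_lt_mul_of_pos_left (Nat.pow_lt_pow_right (by omega) (by omega)) hs₀
  have block_ends_primrec : Primrec fun j => s * (l + 2) ^ (j + 1) :=
    Primrec.nat_mul.comp (.const s) (primrec₂_pow.comp (.const (l + 2)) .succ)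
  obtain ⟨S, hS, S_computable, large⟩ := exists_infinite_computablePred_of_eventually
    (p := fun n : ℕ => (1 - δ) * n < plainK U (initSeg (blockSeq s (l + 2) E x y) n))
    block_ends_primrec block_ends_mono
    (hE.eventually_lt_plainK_blockSeq hU hs₀ ((le_max_right _ _).trans hs) hδl hxy hx hy)
  exact ⟨(Nat.frequently_atTop_iff_infinite.2 hS).mono large, S, hS, S_computable, large⟩
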